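/- Let $n,m,k,l\ge 0$ be integers with $k+l\le m$, let $\alpha,\beta>-1$, let $r_0,\dots,r_n\in\mathbb R$ and let $\omega_0,\dots,\omega_n>0$. Put $B^N_i(t)=\binom Ni t^i(1-t)^{N-i}$, $\omega(t)=\sum_{i=0}^n\omega_iB^n_i(t)$, $R_n(t)=\omega(t)^{-1}\sum_{i=0}^n\omega_ir_iB^n_i(t)$ for $0\le t\le 1$, and $\langle f,g\rangle=\int_0^1(1-t)^\alpha t^\beta f(t)g(t)\,dt$. Consider the problem of minimising $\langle R_n-P_m,R_n-P_m\rangle$ over all real polynomials $P_m$ of degree at most $m$ such that $$P_m^{(i)}(0)=R_n^{(i)}(0)\ (0\le i\le k-1),\qquad P_m^{(j)}(1)=R_n^{(j)}(1)\ (0\le j\le l-1).$$ Notation. Let $\Pi_m^{(k,l)}$ be the space of polynomials $P$ of degree at most $m$ with $P^{(i)}(0)=0$ for $0\le i\le k-1$ and $P^{(j)}(1)=0$ for $0\le j\le l-1$. For $k\le i\le m-l$, the constrained dual Bernstein polynomial $D_i\in\Pi_m^{(k,l)}$ is defined by $\langle D_i,B^m_j\rangle=\delta_{ij}$ $(k\le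 j\le m-l)$, and the numbers $c_{ij}$ $(k\le i,j\le m-l)$ are its Bernstein coefficients, $D_i=\sum_{j=k}^{m-l}c_{ij}B^m_j$. Let $(a)_N=\prod_{s=0}^{N-1}(a+s)$ and $I_h=\int_0^1(1-t)^\alpha t^\beta B^{n+m}_h(t)/\omega(t)\,dt$. For $k\le i\le m-l$ and $0\le j<k$ or $m-l<j\le m$, let $$K_{ij}=\binom mj\binom mi^{-1}\frac{(-1)^{i-k}(k-j)_{m-k-l+1}}{(i-j)\,(i-k)!\,(m-l-i)!}\cdot\frac{(\alpha+l+1)_{m-j}(\beta+k+1)_j}{(\alpha+l+1)_{m-i}(\beta+k+1)_i}.$$ Let $\Delta^0a_h=a_h$, $\Delta^ja_h=\Delta^{j-1}a_{h+1}-\Delta^{j-1}a_h$, and define, for $i=0,1,2,\dots$, $$\varrho_{i0}=\frac{n!}{\omega_0}\Big[\frac{\Delta^i(\omega_0r_0)}{(n-i)!}-\sum_{j=0}^{i-1}\binom ij\frac{\Delta^{i-j}\omega_0}{(n-i+j)!}\varrho_{j0}\Big],$$ $$\varrho_{i1}=\frac{n!}{\omega_n}\Big[\frac{\Delta^i(\omega_{n-i}r_{n-i})}{(n-i)!}-\sum_{j=0}^{i-1}\binom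 ij\frac{\Delta^{i-j}\omega_{n-i+j}}{(n-i+j)!}\varrho_{j1}\Big],$$ where any term containing $1/s!$ with $s<0$ is read as $0$. Theorem. The polynomials $D_i$ exist, are unique, and have such coefficients $c_{ij}$; $\varrho_{i0}=R_n^{(i)}(0)$ and $\varrho_{i1}=R_n^{(i)}(1)$ for all $i\ge0$; the minimisation problem has exactly one solution. Moreover $P_m=\sum_{i=0}^mp_iB^m_i$ is the solution if and only if $$p_i=\frac{(m-i)!}{m!}\varrho_{i0}-\sum_{j=0}^{i-1}(-1)^{i+j}\binom ij p_j\qquad(i=0,\dots,k-1),$$ $$p_{m-i}=(-1)^i\frac{(m-i)!}{m!}\varrho_{i1}-\sum_{j=1}^{i}(-1)^j\binom ij p_{m-i+j}\qquad(i=0,\dots,l-1),$$ $$p_i=\sum_{h=0}^n\binom nh\omega_hr_h\sum_{j=k}^{m-l}\binom mj\binom{n+m}{j+h}^{-1}c_{ij}I_{j+h}-\Big(\sum_{j=0}^{k-1}+\sum_{j=m-l+1}^{m}\Big)p_jK_{ij}\qquad(i=k,\dots,m-l).$$ -/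

import Mathlib

open Finset Polynomial
open scoped Nat

noncomputable section

/-- The polynomial `∑_{i=0}^{m} p_i B^m_i` with Bernstein (Bezier) coefficients `p_0, …, p_m`. -/
def bernsteinForm (m : ℕ) (p : ℕ → ℝ) : ℝ[X] :=
  ∑ i ∈ range (m + 1), C (p i) * bernsteinPolynomial ℝ m i

/-- The rational Bezier function `(∑ ω_i r_i B^n_i(t)) / (∑ ω_i B^n_i(t))`. -/
def rationalBezier (n : ℕ) (ω r : ℕ → ℝ) (t : ℝ) : ℝ :=
  (bernsteinForm n (fun i => ω i * r i)).eval t / (bernsteinForm n ω).eval t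

/-- The Jacobi inner product `⟨f, g⟩ = ∫_0^1 (1-t)^α t^β f(t) g(t) dt`. -/
def jacobiInner (α β : ℝ) (f g : ℝ → ℝ) : ℝ :=
  ∫ t in (0 : ℝ)..1, (1 - t) ^ α * t ^ β * f t * g t

/-- The weight is integrable on `[0,1]` when `α, β > -1`, hence so is its product with any
function continuous on `[0,1]`: all integrals below converge. -/
theorem jacobi_intervalIntegrable {α β : ℝ} (hα : -1 < α) (hβ : -1 < β) {f : ℝ → ℝ}
    (hf : ContinuousOn f (Set.Icc 0 1)) :
    IntervalIntegrable (fun t : ℝ => (1 - t) ^ α * t ^ β * f t) MeasureTheory.volume 0 1 := by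
  have h := (Complex.betaIntegral_convergent (u := ((β + 1 : ℝ) : ℂ)) (v := ((α + 1 : ℝ) : ℂ))
    (by rw [Complex.ofReal_re]; linarith) (by rw [Complex.ofReal_re]; linarith)).norm
  have hw : IntervalIntegrable (fun t : ℝ => (1 - t) ^ α * t ^ β)
      MeasureTheory.volume 0 1 := by
    rw [intervalIntegrable_iff_integrableOn_Ioo_of_le zero_le_one] at h ⊢
    refine h.congr_fun (fun t ht => ?_) measurableSet_Ioo
    have h1 : 0 < 1 - t := by linarith [ht.2]
    have e1 : (1 : ℂ) - (t : ℂ) = ((1 - t : ℝ) : ℂ) := by push_cast; ring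
    simp only [norm_mul]
    rw [e1, Complex.norm_cpow_eq_rpow_re_of_pos ht.1, Complex.norm_cpow_eq_rpow_re_of_pos h1,
      mul_comm]
    simp
  exact hw.mul_continuousOn (by rwa [Set.uIcc_of_le zero_le_one])

/-- `P` belongs to `Π_m^{(k,l)}`: it has degree at most `m`, its derivatives of order `< k` vanish
at `0` and its derivatives of order `< l` vanish at `1`. -/
def InConstrainedSpace (m k l : ℕ) (P : ℝ[X]) : Prop :=
  P.natDegree ≤ m ∧ (∀ i < k, (derivative^[i] P).eval 0 = 0) ∧
    ∀ j < l, (derivative^[j] P).eval 1 = 0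

/-- `D` is the `i`-th constrained dual Bernstein polynomial `D_i^{(m,k,l)}(·; α, β)`: it lies in
`Π_m^{(k,l)}` and `⟨D, B^m_j⟩ = δ_{ij}` for `k ≤ j ≤ m - l`. -/
def IsConstrainedDual (m k l : ℕ) (α β : ℝ) (i : ℕ) (D : ℝ[X]) : Prop :=
  InConstrainedSpace m k l D ∧ ∀ j ∈ Icc k (m - l),
    jacobiInner α β (fun t => D.eval t) (fun t => (bernsteinPolynomial ℝ m j).eval t) =
      if i = j then 1 else 0

/-- `c i j`, for `k ≤ i, j ≤ m - l`, are the Bernstein coefficients of the constrained dual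
Bernstein polynomials: `D_i = ∑_{j=k}^{m-l} c_{ij} B^m_j`. -/
def IsDualCoefficients (m k l : ℕ) (α β : ℝ) (c : ℕ → ℕ → ℝ) : Prop :=
  ∀ i ∈ Icc k (m - l), IsConstrainedDual m k l α β i
    (∑ j ∈ Icc k (m - l), C (c i j) * bernsteinPolynomial ℝ m j)

/-- `P` is admissible: it has degree at most `m` and satisfies the Hermite constraints
`P^{(i)}(0) = R^{(i)}(0)` for `i < k` and `P^{(j)}(1) = R^{(j)}(1)` for `j < l`, where
`R` is a function on `[0,1]` (so its derivatives at the end points are one-sided). -/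
def IsAdmissible (m k l : ℕ) (R : ℝ → ℝ) (P : ℝ[X]) : Prop :=
  P.natDegree ≤ m ∧
    (∀ i < k, (derivative^[i] P).eval 0 = iteratedDerivWithin i R (Set.Icc 0 1) 0) ∧
    ∀ j < l, (derivative^[j] P).eval 1 = iteratedDerivWithin j R (Set.Icc 0 1) 1

/-- The squared error `‖R - P‖² = ⟨R - P, R - P⟩`. -/
def sqError (α β : ℝ) (R : ℝ → ℝ) (P : ℝ[X]) : ℝ :=
  jacobiInner α β (fun t => R t - P.eval t) (fun t => R t - P.eval t)

/-- `P` minimises the squared error among all admissible polynomials. -/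
def IsBestApprox (m k l : ℕ) (α β : ℝ) (R : ℝ → ℝ) (P : ℝ[X]) : Prop :=
  IsAdmissible m k l R P ∧
    ∀ S : ℝ[X], IsAdmissible m k l R S → sqError α β R P ≤ sqError α β R S

/-- `1 / (n - s)!`, with the usual convention that it is `0` if `s > n`. -/
def recipFactorialSub (n s : ℕ) : ℝ := if s ≤ n then 1 / ((n - s)! : ℝ) else 0

/-- The numbers `ϱ_{i0}`. Where a difference would involve an index above `n`,
its factor `recipFactorialSub` is zero. -/
def rhoZero (n : ℕ) (ω r : ℕ → ℝ) (i : ℕ) : ℝ :=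
  (n ! : ℝ) / ω 0 *
    (recipFactorialSub n i * (fwdDiff 1)^[i] (fun s => ω s * r s) 0 -
      ∑ j : Fin i, (i.choose j : ℝ) * (fwdDiff 1)^[i - j] ω 0 *
        recipFactorialSub n (i - j) * rhoZero n ω r j)
termination_by i
decreasing_by exact j.2

/-- The numbers `ϱ_{i1}`; here `n - i + j` is written `n - (i - j)`, and where this would be
negative the factor `recipFactorialSub` is zero. -/
def rhoOne (n : ℕ) (ω r : ℕ → ℝ) (i : ℕ) : ℝ :=
  (n ! : ℝ) / ω n *
    (recipFactorialSub n i * (fwdDiff 1)^[i] (fun s => ω s * r s) (n - i) -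
      ∑ j : Fin i, (i.choose j : ℝ) * (fwdDiff 1)^[i - j] ω (n - (i - j)) *
        recipFactorialSub n (i - j) * rhoOne n ω r j)
termination_by i
decreasing_by exact j.2

/-- `I_h = ∫_0^1 (1-t)^α t^β B^{n+m}_h(t) / ω(t) dt`, where `ω(t) = ∑ ω_i B^n_i(t)`. -/
def weightedIntegral (n m : ℕ) (α β : ℝ) (ω : ℕ → ℝ) (h : ℕ) : ℝ :=
  ∫ t in (0 : ℝ)..1, (1 - t) ^ α * t ^ β * (bernsteinPolynomial ℝ (n + m) h).eval t /
    (bernsteinForm n ω).eval t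

/-- The rising factorial `(a)_N = a (a + 1) ⋯ (a + N - 1)`. -/
def risingFactorial (a : ℝ) (N : ℕ) : ℝ := ∏ s ∈ range N, (a + s)

/-- The numbers `K_{ij}`, for `k ≤ i ≤ m - l` and `j < k` or `m - l < j ≤ m`. -/
def kernelCoeff (m k l : ℕ) (α β : ℝ) (i j : ℕ) : ℝ :=
  (m.choose j : ℝ) * (m.choose i : ℝ)⁻¹ *
    ((-1) ^ (i - k) * risingFactorial ((k : ℝ) - j) (m - k - l + 1) /
      (((i : ℝ) - j) * ((i - k)! : ℝ) * ((m - l - i)! : ℝ))) *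
    (risingFactorial (α + l + 1) (m - j) * risingFactorial (β + k + 1) j /
      (risingFactorial (α + l + 1) (m - i) * risingFactorial (β + k + 1) i))

end

noncomputable section

/-! A best approximation is an admissible `P` whose error is orthogonal to `Π_m^{(k,l)}`
(`isBestApprox_iff_orthogonal`). The dual polynomials `D_i` span this space, so the condition reads
`⟨P, D_i⟩ = ⟨R_n, D_i⟩` for each inner index `i` (`isBestApprox_iff_dual`). On the left, duality
leaves `p_i` from the inner Bernstein terms, and each outer term contributes `p_j ⟨D_i, B^m_j⟩`. On
the right, a product of Bernstein polynomials is a multiple of a Bernstein polynomial of degree `n +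
m`, which produces the integrals `I_h`.

The crux is `⟨D_i, B^m_j⟩ = K_{ij}` for outer `j`. By the beta integral, the moments of an element
of `Π_m^{(k,l)}` are explicit factors times `Q(j)`, with `Q` of degree at most `m - k - l`
(`exists_moment_polynomial`). For `D_i` this `Q` vanishes at every inner node except `i`, so
Lagrange extrapolation determines it (`eval_eq_of_vanish`).

End point derivatives are triangular in the Bernstein coefficients, which turns the Hermite
constraints into recursions; `ϱ` comes from the Leibniz rule for `R_n ω`. Existence and uniqueness
both follow from a dimension count (`existsUnique_hermiteMoments`). -/

/-! ### End point derivatives of Bernstein forms. -/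

theorem derivative_bernsteinForm (m : ℕ) (p : ℕ → ℝ) :
    derivative (bernsteinForm m p) = C (m : ℝ) * bernsteinForm (m - 1) (fwdDiff 1 p) := by
  cases m with
  | zero => simp [bernsteinForm, bernsteinPolynomial]
  | succ M =>
    -- Index shift: the surplus top term vanishes because `B^M_{M+1} = 0`.
    have key : ∑ i ∈ range (M + 1), C (p (i + 1)) * bernsteinPolynomial ℝ M (i + 1) +
        C (p 0) * bernsteinPolynomial ℝ M 0 =
        ∑ i ∈ range (M + 1), C (p i) * bernsteinPolynomial ℝ M i := by
      rw [← sum_range_succ' (fun i => C (p i) * bernsteinPolynomial ℝ M i) (M + 1),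
        sum_range_succ, bernsteinPolynomial.eq_zero_of_lt ℝ (Nat.lt_succ_self M)]
      simp
    unfold bernsteinForm
    rw [sum_range_succ']
    simp only [derivative_add, derivative_sum, derivative_mul, derivative_C, zero_mul, zero_add,
      bernsteinPolynomial.derivative_succ, bernsteinPolynomial.derivative_zero,
      Nat.add_sub_cancel, fwdDiff, C_sub, sub_mul, sum_sub_distrib]
    rw [← key]
    have : ∑ i ∈ range (M + 1), C (p (i + 1)) * (((M + 1 : ℕ) : ℝ[X]) *
        (bernsteinPolynomial ℝ M i - bernsteinPolynomial ℝ M (i + 1))) =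
        ((M + 1 : ℕ) : ℝ[X]) * (∑ i ∈ range (M + 1), C (p (i + 1)) * bernsteinPolynomial ℝ M i -
          ∑ i ∈ range (M + 1), C (p (i + 1)) * bernsteinPolynomial ℝ M (i + 1)) := by
      rw [← sum_sub_distrib, mul_sum]
      exact sum_congr rfl fun i _ => by ring
    rw [this, ← C_eq_natCast]
    simp only [map_natCast]
    ring

theorem iterate_derivative_bernsteinForm (m : ℕ) (p : ℕ → ℝ) (i : ℕ) :
    derivative^[i] (bernsteinForm m p) =
      C (m.descFactorial i : ℝ) * bernsteinForm (m - i) ((fwdDiff 1)^[i] p) := by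
  induction i with
  | zero => simp
  | succ i ih =>
    rw [Function.iterate_succ_apply', ih, derivative_C_mul, derivative_bernsteinForm,
      Function.iterate_succ_apply', Nat.descFactorial_succ, Nat.sub_sub]
    push_cast
    rw [C_mul]
    ring

theorem eval_zero_bernsteinForm (m : ℕ) (p : ℕ → ℝ) : (bernsteinForm m p).eval 0 = p 0 := by
  simp [bernsteinForm, eval_finsetSum, bernsteinPolynomial.eval_at_0]

theorem eval_one_bernsteinForm (m : ℕ) (p : ℕ → ℝ) : (bernsteinForm m p).eval 1 = p m := by
  simp [bernsteinForm, eval_finsetSum, bernsteinPolynomial.eval_at_1]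

theorem iterate_derivative_bernsteinForm_eval_zero (m : ℕ) (p : ℕ → ℝ) (i : ℕ) :
    (derivative^[i] (bernsteinForm m p)).eval 0 =
      (m.descFactorial i : ℝ) * (fwdDiff 1)^[i] p 0 := by
  rw [iterate_derivative_bernsteinForm, eval_mul, eval_C, eval_zero_bernsteinForm]

theorem iterate_derivative_bernsteinForm_eval_one (m : ℕ) (p : ℕ → ℝ) (i : ℕ) :
    (derivative^[i] (bernsteinForm m p)).eval 1 =
      (m.descFactorial i : ℝ) * (fwdDiff 1)^[i] p (m - i) := by
  rw [iterate_derivative_bernsteinForm, eval_mul, eval_C, eval_one_bernsteinForm]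

theorem fwdDiff_iter_eq_sum_real (p : ℕ → ℝ) (i y : ℕ) :
    (fwdDiff 1)^[i] p y =
      ∑ j ∈ range (i + 1), (-1) ^ (i + j) * (i.choose j : ℝ) * p (y + j) := by
  rw [fwdDiff_iter_eq_sum_shift]
  refine sum_congr rfl fun j hj => ?_
  obtain ⟨d, rfl⟩ := Nat.exists_eq_add_of_le (Nat.lt_succ_iff.mp (mem_range.mp hj))
  have : (-1 : ℝ) ^ (j + d + j) = (-1) ^ d := by
    rw [show j + d + j = d + 2 * j by ring, pow_add, pow_mul]; simp
  rw [this]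
  simp

theorem descFactorial_mul_eq_iff {m i : ℕ} (hi : i ≤ m) (x y : ℝ) :
    (m.descFactorial i : ℝ) * x = y ↔ x = ((m - i)! : ℝ) / (m ! : ℝ) * y := by
  have h : ((m - i)! : ℝ) * (m.descFactorial i : ℝ) = (m ! : ℝ) := by
    exact_mod_cast Nat.factorial_mul_descFactorial hi
  have h1 : ((m - i)! : ℝ) ≠ 0 := by positivity
  have h2 : (m ! : ℝ) ≠ 0 := by positivity
  rw [← h] at h2 ⊢
  have h3 := right_ne_zero_of_mul h2
  constructor
  · rintro rfl; field_simp
  · rintro rfl; field_simp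

/-- The `i`-th derivative at `0` prescribes the `i`-th Bernstein coefficient in terms of the
previous ones. -/
theorem iterate_derivative_bernsteinForm_eval_zero_eq_iff {m i : ℕ} (hi : i ≤ m) (p : ℕ → ℝ)
    (y : ℝ) : (derivative^[i] (bernsteinForm m p)).eval 0 = y ↔
      p i = ((m - i)! : ℝ) / (m ! : ℝ) * y -
        ∑ j ∈ range i, (-1) ^ (i + j) * (i.choose j : ℝ) * p j := by
  rw [iterate_derivative_bernsteinForm_eval_zero, descFactorial_mul_eq_iff hi,
    fwdDiff_iter_eq_sum_real, sum_range_succ, ← two_mul, pow_mul]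
  simp only [even_two, Even.neg_pow, one_pow, Nat.choose_self, Nat.cast_one, one_mul, zero_add]
  rw [eq_sub_iff_add_eq, add_comm]

/-- The `i`-th derivative at `1` prescribes the `(m - i)`-th Bernstein coefficient in terms of the
following ones. -/
theorem iterate_derivative_bernsteinForm_eval_one_eq_iff {m i : ℕ} (hi : i ≤ m) (p : ℕ → ℝ)
    (y : ℝ) : (derivative^[i] (bernsteinForm m p)).eval 1 = y ↔
      p (m - i) = (-1) ^ i * (((m - i)! : ℝ) / (m ! : ℝ)) * y -
        ∑ j ∈ Icc 1 i, (-1) ^ j * (i.choose j : ℝ) * p (m - i + j) := by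
  have e : ((-1 : ℝ) ^ i) * (-1) ^ i = 1 := by rw [← pow_add, ← two_mul, pow_mul]; simp
  have hs : ∑ j ∈ range (i + 1), (-1) ^ (i + j) * (i.choose j : ℝ) * p (m - i + j) =
      (-1) ^ i * (p (m - i) + ∑ j ∈ Icc 1 i, (-1) ^ j * (i.choose j : ℝ) * p (m - i + j)) := by
    rw [range_eq_Ico, sum_eq_sum_Ico_succ_bot (Nat.succ_pos i), mul_add, mul_sum]
    congr 1
    · simp
    · exact sum_congr rfl fun j _ => by rw [pow_add]; ring
  rw [iterate_derivative_bernsteinForm_eval_one, descFactorial_mul_eq_iff hi,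
    fwdDiff_iter_eq_sum_real, hs, eq_sub_iff_add_eq]
  constructor <;> intro h
  · rw [mul_assoc, ← h, ← mul_assoc, e, one_mul]
  · rw [h, ← mul_assoc, ← mul_assoc, e, one_mul]

theorem natDegree_bernsteinForm_le (m : ℕ) (p : ℕ → ℝ) : (bernsteinForm m p).natDegree ≤ m := by
  refine natDegree_sum_le_of_forall_le _ _ fun i hi => (natDegree_C_mul_le _ _).trans ?_
  have hi' : i ≤ m := Nat.lt_succ_iff.mp (mem_range.mp hi)
  unfold bernsteinPolynomial
  have h1 : ((m.choose i : ℝ[X]) * X ^ i).natDegree ≤ i := by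
    rw [← C_eq_natCast]; exact natDegree_C_mul_X_pow_le _ _
  have h2 : ((1 - X : ℝ[X]) ^ (m - i)).natDegree ≤ m - i := by
    refine natDegree_pow_le_of_le _ ?_ |>.trans (mul_one _).le
    compute_degree
  exact natDegree_mul_le_of_le h1 h2 |>.trans (by omega)

theorem bernsteinForm_congr {m : ℕ} {p q : ℕ → ℝ} (h : ∀ i ≤ m, p i = q i) :
    bernsteinForm m p = bernsteinForm m q :=
  sum_congr rfl fun i hi => by rw [h i (Nat.lt_succ_iff.mp (mem_range.mp hi))]

/-- Vanishing derivatives at `0` force the first Bernstein coefficients to vanish. -/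
theorem coeff_eq_zero_of_iterate_derivative_eval_zero {m k : ℕ} (hk : k ≤ m + 1) {p : ℕ → ℝ}
    (h : ∀ i < k, (derivative^[i] (bernsteinForm m p)).eval 0 = 0) : ∀ i < k, p i = 0 := by
  intro i
  induction i using Nat.strong_induction_on with
  | _ i ih =>
    intro hi
    rw [(iterate_derivative_bernsteinForm_eval_zero_eq_iff (by omega) p 0).1 (h i hi),
      sum_eq_zero]
    · simp
    · intro j hj
      rw [ih j (mem_range.mp hj) ((mem_range.mp hj).trans hi), mul_zero]

/-- Vanishing derivatives at `1` force the last Bernstein coefficients to vanish. -/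
theorem coeff_eq_zero_of_iterate_derivative_eval_one {m l : ℕ} (hl : l ≤ m + 1) {p : ℕ → ℝ}
    (h : ∀ i < l, (derivative^[i] (bernsteinForm m p)).eval 1 = 0) :
    ∀ i < l, p (m - i) = 0 := by
  intro i
  induction i using Nat.strong_induction_on with
  | _ i ih =>
    intro hi
    rw [(iterate_derivative_bernsteinForm_eval_one_eq_iff (by omega) p 0).1 (h i hi),
      sum_eq_zero]
    · simp
    · intro j hj
      have hj' := mem_Icc.mp hj
      rw [show m - i + j = m - (i - j) by omega, ih (i - j) (by omega) (by omega), mul_zero]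

/-! ### The Bernstein basis and the constrained space. -/

/-- The polynomials of degree at most `m` parametrised by their coefficients. -/
def formLinearMap (m : ℕ) : (Fin (m + 1) → ℝ) →ₗ[ℝ] degreeLT ℝ (m + 1) where
  toFun p := ⟨bernsteinForm m (fun i => if h : i < m + 1 then p ⟨i, h⟩ else 0),
    mem_degreeLT.2 (lt_of_le_of_lt (natDegree_le_iff_degree_le.1 (natDegree_bernsteinForm_le _ _))
      (by exact_mod_cast Nat.lt_succ_self m))⟩
  map_add' p q := by
    ext1
    simp only [bernsteinForm, Submodule.coe_add, ← sum_add_distrib]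
    refine sum_congr rfl fun i hi => ?_
    simp [mem_range.mp hi, add_mul]
  map_smul' a p := by
    ext1
    simp only [bernsteinForm, Submodule.coe_smul, smul_sum, RingHom.id_apply]
    refine sum_congr rfl fun i hi => ?_
    simp [mem_range.mp hi, smul_eq_C_mul, mul_assoc]

/-- Dimension count: the zero form has zero derivatives at `0`, hence zero coefficients by
triangularity, so the coefficient map is injective between spaces of dimension `m + 1` and therefore
onto. -/
theorem exists_bernsteinForm_eq {m : ℕ} {P : ℝ[X]} (hP : P.natDegree ≤ m) :
    ∃ p : ℕ → ℝ, P = bernsteinForm m p := by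
  have hinj : Function.Injective (formLinearMap m) := by
    rw [← LinearMap.ker_eq_bot, LinearMap.ker_eq_bot']
    intro p hp
    have hp' := congrArg Subtype.val hp
    have h := coeff_eq_zero_of_iterate_derivative_eval_zero (m := m) le_rfl
      (p := fun i => if h : i < m + 1 then p ⟨i, h⟩ else 0) (fun i _ => by
        change bernsteinForm m _ = 0 at hp'
        rw [hp']; simp)
    ext i
    simpa [i.2] using h i i.2
  have hfin : FiniteDimensional ℝ (degreeLT ℝ (m + 1)) :=
    (degreeLTEquiv ℝ (m + 1)).symm.finiteDimensional
  have hsurj := (LinearMap.injective_iff_surjective_of_finrank_eq_finrank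
    (degreeLTEquiv ℝ (m + 1)).symm.finrank_eq).1 hinj
  obtain ⟨p, hp⟩ := hsurj ⟨P, mem_degreeLT.2 (lt_of_le_of_lt (natDegree_le_iff_degree_le.1 hP)
    (by exact_mod_cast Nat.lt_succ_self m))⟩
  exact ⟨_, (congrArg Subtype.val hp).symm⟩

theorem sum_Icc_eq_bernsteinForm {m a b : ℕ} (hb : b ≤ m) (p : ℕ → ℝ) :
    ∑ j ∈ Icc a b, C (p j) * bernsteinPolynomial ℝ m j =
      bernsteinForm m (fun j => if j ∈ Icc a b then p j else 0) := by
  unfold bernsteinForm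
  symm
  rw [← sum_subset (s₁ := Icc a b)]
  · exact sum_congr rfl fun j hj => by simp only [if_pos hj]
  · intro j hj
    rw [mem_Icc] at hj
    rw [mem_range]; omega
  · intro j _ hj
    simp only [if_neg hj, C_0, zero_mul]

theorem inConstrainedSpace_sum {m k l : ℕ} (hkl : k + l ≤ m) (c : ℕ → ℝ) :
    InConstrainedSpace m k l (∑ j ∈ Icc k (m - l), C (c j) * bernsteinPolynomial ℝ m j) := by
  rw [sum_Icc_eq_bernsteinForm (Nat.sub_le m l)]
  refine ⟨natDegree_bernsteinForm_le _ _, fun i hi => ?_, fun i hi => ?_⟩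
  · rw [iterate_derivative_bernsteinForm_eval_zero_eq_iff (by omega), sum_eq_zero]
    · rw [if_neg (by rw [mem_Icc]; omega)]; simp
    · intro j hj
      have := mem_range.mp hj
      rw [if_neg (by rw [mem_Icc]; omega), mul_zero]
  · rw [iterate_derivative_bernsteinForm_eval_one_eq_iff (by omega), sum_eq_zero]
    · rw [if_neg (by rw [mem_Icc]; omega)]; simp
    · intro j hj
      have := mem_Icc.mp hj
      rw [if_neg (by rw [mem_Icc]; omega), mul_zero]

/-- The vanishing conditions kill the first `k` and the last `l` Bernstein coefficients. With
`inConstrainedSpace_sum`, the span of the inner Bernstein polynomials is exactly `Π_m^{(k,l)}`. -/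
theorem InConstrainedSpace.exists_eq_sum {m k l : ℕ} (hkl : k + l ≤ m) {P : ℝ[X]}
    (hP : InConstrainedSpace m k l P) :
    ∃ c : ℕ → ℝ, P = ∑ j ∈ Icc k (m - l), C (c j) * bernsteinPolynomial ℝ m j := by
  obtain ⟨p, rfl⟩ := exists_bernsteinForm_eq hP.1
  refine ⟨p, ?_⟩
  rw [sum_Icc_eq_bernsteinForm (Nat.sub_le m l)]
  refine bernsteinForm_congr fun i hi => ?_
  split_ifs with h
  · rfl
  · rw [mem_Icc, not_and_or, not_le, not_le] at h
    rcases h with h | h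
    · exact coeff_eq_zero_of_iterate_derivative_eval_zero (by omega) hP.2.1 i h
    · have := coeff_eq_zero_of_iterate_derivative_eval_one (by omega) hP.2.2 (m - i) (by omega)
      rwa [show m - (m - i) = i by omega] at this

theorem InConstrainedSpace.add {m k l : ℕ} {P Q : ℝ[X]} (hP : InConstrainedSpace m k l P)
    (hQ : InConstrainedSpace m k l Q) : InConstrainedSpace m k l (P + Q) :=
  ⟨natDegree_add_le_of_degree_le hP.1 hQ.1,
    fun i hi => by simp [iterate_map_add, hP.2.1 i hi, hQ.2.1 i hi],
    fun i hi => by simp [iterate_map_add, hP.2.2 i hi, hQ.2.2 i hi]⟩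

theorem InConstrainedSpace.C_mul {m k l : ℕ} {P : ℝ[X]} (hP : InConstrainedSpace m k l P)
    (a : ℝ) : InConstrainedSpace m k l (C a * P) :=
  ⟨(natDegree_C_mul_le _ _).trans hP.1,
    fun i hi => by simp [iterate_derivative_C_mul, hP.2.1 i hi],
    fun i hi => by simp [iterate_derivative_C_mul, hP.2.2 i hi]⟩

theorem InConstrainedSpace.sub {m k l : ℕ} {P Q : ℝ[X]} (hP : InConstrainedSpace m k l P)
    (hQ : InConstrainedSpace m k l Q) : InConstrainedSpace m k l (P - Q) := by
  simpa [sub_eq_add_neg] using hP.add (hQ.C_mul (-1))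

/-! ### Bilinearity and definiteness of the Jacobi inner product. -/

theorem jacobiInner_comm (α β : ℝ) (f g : ℝ → ℝ) : jacobiInner α β f g = jacobiInner α β g f := by
  unfold jacobiInner
  congr 1
  ext t
  ring

theorem jacobiInner_intervalIntegrable {α β : ℝ} (hα : -1 < α) (hβ : -1 < β) {f g : ℝ → ℝ}
    (hf : ContinuousOn f (Set.Icc 0 1)) (hg : ContinuousOn g (Set.Icc 0 1)) :
    IntervalIntegrable (fun t : ℝ => (1 - t) ^ α * t ^ β * f t * g t)
      MeasureTheory.volume 0 1 := by
  simpa only [mul_assoc] using jacobi_intervalIntegrable hα hβ (f := fun t => f t * g t) (hf.mul hg)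

theorem jacobiInner_add_left {α β : ℝ} (hα : -1 < α) (hβ : -1 < β) {f g h : ℝ → ℝ}
    (hf : ContinuousOn f (Set.Icc 0 1)) (hg : ContinuousOn g (Set.Icc 0 1))
    (hh : ContinuousOn h (Set.Icc 0 1)) :
    jacobiInner α β (fun t => f t + g t) h = jacobiInner α β f h + jacobiInner α β g h := by
  unfold jacobiInner
  rw [← intervalIntegral.integral_add (jacobiInner_intervalIntegrable hα hβ hf hh)
    (jacobiInner_intervalIntegrable hα hβ hg hh)]
  congr 1
  ext t
  ring

theorem jacobiInner_const_mul_left (α β a : ℝ) (f h : ℝ → ℝ) :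
    jacobiInner α β (fun t => a * f t) h = a * jacobiInner α β f h := by
  unfold jacobiInner
  rw [← intervalIntegral.integral_const_mul]
  congr 1
  ext t
  ring

theorem jacobiInner_sub_left {α β : ℝ} (hα : -1 < α) (hβ : -1 < β) {f g h : ℝ → ℝ}
    (hf : ContinuousOn f (Set.Icc 0 1)) (hg : ContinuousOn g (Set.Icc 0 1))
    (hh : ContinuousOn h (Set.Icc 0 1)) :
    jacobiInner α β (fun t => f t - g t) h = jacobiInner α β f h - jacobiInner α β g h := by
  have := jacobiInner_add_left hα hβ hf (continuousOn_const.mul hg) hh (g := fun t => (-1) * g t)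
  rw [jacobiInner_const_mul_left] at this
  simpa only [neg_one_mul, ← sub_eq_add_neg] using this

theorem jacobiInner_sum_left {α β : ℝ} (hα : -1 < α) (hβ : -1 < β) {ι : Type*} (s : Finset ι)
    {f : ι → ℝ → ℝ} {h : ℝ → ℝ} (hf : ∀ i ∈ s, ContinuousOn (f i) (Set.Icc 0 1))
    (hh : ContinuousOn h (Set.Icc 0 1)) :
    jacobiInner α β (fun t => ∑ i ∈ s, f i t) h = ∑ i ∈ s, jacobiInner α β (f i) h := by
  unfold jacobiInner
  rw [← intervalIntegral.integral_finsetSum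
    fun i hi => jacobiInner_intervalIntegrable hα hβ (hf i hi) hh]
  congr 1
  ext t
  rw [mul_sum, sum_mul]

theorem continuousOn_eval (P : ℝ[X]) (s : Set ℝ) : ContinuousOn (fun t => P.eval t) s :=
  P.continuous.continuousOn

theorem continuousOn_sub_eval {R : ℝ → ℝ} {s : Set ℝ} (hR : ContinuousOn R s) (P : ℝ[X]) :
    ContinuousOn (fun t => R t - P.eval t) s :=
  hR.sub (continuousOn_eval P s)

theorem jacobiInner_self_nonneg (α β : ℝ) (f : ℝ → ℝ) : 0 ≤ jacobiInner α β f f := by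
  refine intervalIntegral.integral_nonneg zero_le_one fun t ht => ?_
  rw [mul_assoc]
  exact mul_nonneg (mul_nonneg (Real.rpow_nonneg (by linarith [ht.2]) _)
    (Real.rpow_nonneg ht.1 _)) (mul_self_nonneg _)

/-- For `P ≠ 0` the integrand is nonnegative, and nonzero on `(0, 1)` off the finite root set of
`P`, so its support has positive measure. -/
theorem eq_zero_of_jacobiInner_self_eq_zero {α β : ℝ} (hα : -1 < α) (hβ : -1 < β) {P : ℝ[X]}
    (h : jacobiInner α β (fun t => P.eval t) (fun t => P.eval t) = 0) : P = 0 := by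
  by_contra hP
  have hint := jacobiInner_intervalIntegrable hα hβ (continuousOn_eval P _) (continuousOn_eval P _)
  have hnn : 0 ≤ᵐ[MeasureTheory.volume.restrict (Set.uIoc 0 1)]
      (fun t : ℝ => (1 - t) ^ α * t ^ β * P.eval t * P.eval t) := by
    rw [Set.uIoc_of_le zero_le_one]
    refine MeasureTheory.ae_restrict_of_forall_mem measurableSet_Ioc fun t ht => ?_
    simp only [Pi.zero_apply]
    rw [mul_assoc]
    exact mul_nonneg (mul_nonneg (Real.rpow_nonneg (by linarith [ht.2]) _)
      (Real.rpow_nonneg ht.1.le _)) (mul_self_nonneg _)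
  have hpos := (intervalIntegral.integral_pos_iff_support_of_nonneg_ae' hnn hint).2 ⟨one_pos, ?_⟩
  · exact hpos.ne' h
  · have hsub : Set.Ioo (0 : ℝ) 1 \ (P.rootSet ℝ) ⊆
        Function.support (fun t : ℝ => (1 - t) ^ α * t ^ β * P.eval t * P.eval t) ∩
          Set.Ioc 0 1 := by
      rintro t ⟨⟨h0, h1⟩, ht⟩
      refine ⟨?_, h0, h1.le⟩
      have hPt : P.eval t ≠ 0 := fun h' => ht (by
        rw [mem_rootSet]
        exact ⟨hP, by simpa using h'⟩)
      have w1 : (1 - t) ^ α ≠ 0 := (Real.rpow_pos_of_pos (by linarith) _).ne'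
      have w2 : t ^ β ≠ 0 := (Real.rpow_pos_of_pos h0 _).ne'
      exact mul_ne_zero (mul_ne_zero (mul_ne_zero w1 w2) hPt) hPt
    refine lt_of_lt_of_le ?_ (MeasureTheory.measure_mono hsub)
    rw [MeasureTheory.measure_sdiff_null ((rootSet_finite P ℝ).measure_zero _)]
    simp

theorem jacobiInner_eval_sum {α β : ℝ} (hα : -1 < α) (hβ : -1 < β) (s : Finset ℕ) (c : ℕ → ℝ)
    (B : ℕ → ℝ[X]) {f : ℝ → ℝ} (hf : ContinuousOn f (Set.Icc 0 1)) :
    jacobiInner α β f (fun t => (∑ j ∈ s, C (c j) * B j).eval t) =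
      ∑ j ∈ s, c j * jacobiInner α β f (fun t => (B j).eval t) := by
  rw [jacobiInner_comm]
  simp only [eval_finsetSum, eval_mul, eval_C]
  rw [jacobiInner_sum_left hα hβ s (f := fun j t => c j * (B j).eval t)
    (fun i _ => continuousOn_const.mul (continuousOn_eval (B i) _)) hf]
  refine sum_congr rfl fun j _ => ?_
  rw [jacobiInner_const_mul_left, jacobiInner_comm]

/-! ### Unique solvability from Hermite data and moments. -/

/-- Expanding one of the two copies of `P` in `⟨P, P⟩` over the inner Bernstein polynomials makes
every term vanish. -/
theorem InConstrainedSpace.eq_zero_of_orthogonal {m k l : ℕ} (hkl : k + l ≤ m) {α β : ℝ}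
    (hα : -1 < α) (hβ : -1 < β) {P : ℝ[X]} (hP : InConstrainedSpace m k l P)
    (h : ∀ j ∈ Icc k (m - l), jacobiInner α β (fun t => P.eval t)
      (fun t => (bernsteinPolynomial ℝ m j).eval t) = 0) : P = 0 := by
  obtain ⟨c, hc⟩ := hP.exists_eq_sum hkl
  refine eq_zero_of_jacobiInner_self_eq_zero hα hβ ?_
  nth_rewrite 2 [hc]
  rw [jacobiInner_eval_sum hα hβ _ _ _ (continuousOn_eval P _)]
  exact sum_eq_zero fun j hj => by rw [h j hj, mul_zero]

/-- Hermite data at both end points together with the inner Bernstein moments, as a linear map. -/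
def hermiteMoments (m k l : ℕ) {α β : ℝ} (hα : -1 < α) (hβ : -1 < β) :
    degreeLT ℝ (m + 1) →ₗ[ℝ] (Fin (m + 1) → ℝ) where
  toFun P i := if (i : ℕ) < k then (derivative^[i] (P : ℝ[X])).eval 0 else
    if (i : ℕ) ≤ m - l then jacobiInner α β (fun t => (P : ℝ[X]).eval t)
      (fun t => (bernsteinPolynomial ℝ m i).eval t)
    else (derivative^[m - i] (P : ℝ[X])).eval 1
  map_add' P Q := by
    ext i
    simp only [Submodule.coe_add, iterate_map_add, eval_add, Pi.add_apply]
    split_ifs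
    · rfl
    · exact jacobiInner_add_left hα hβ (continuousOn_eval _ _) (continuousOn_eval _ _)
        (continuousOn_eval _ _)
    · rfl
  map_smul' a P := by
    ext i
    simp only [Submodule.coe_smul, smul_eq_C_mul, iterate_derivative_C_mul, eval_mul, eval_C,
      Pi.smul_apply, smul_eq_mul, RingHom.id_apply]
    split_ifs
    · rfl
    · exact jacobiInner_const_mul_left _ _ _ _ _
    · rfl

theorem mem_degreeLT_succ_iff {m : ℕ} {P : ℝ[X]} :
    P ∈ degreeLT ℝ (m + 1) ↔ P.natDegree ≤ m := by
  rw [mem_degreeLT, degree_lt_iff_coeff_zero, natDegree_le_iff_coeff_eq_zero]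
  rfl

/-- There are `k + (m - l - k + 1) + l = m + 1` linear data on a space of dimension `m + 1`, so
injectivity suffices; the difference of two solutions is a constrained polynomial orthogonal to the
inner basis. Different data yield both the dual polynomials and the best approximation. -/
theorem existsUnique_hermiteMoments {m k l : ℕ} (hkl : k + l ≤ m) {α β : ℝ} (hα : -1 < α)
    (hβ : -1 < β) (a b d : ℕ → ℝ) :
    ∃! P : ℝ[X], P.natDegree ≤ m ∧ (∀ i < k, (derivative^[i] P).eval 0 = a i) ∧
      (∀ i < l, (derivative^[i] P).eval 1 = b i) ∧
      ∀ j ∈ Icc k (m - l), jacobiInner α β (fun t => P.eval t)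
        (fun t => (bernsteinPolynomial ℝ m j).eval t) = d j := by
  have huniq : ∀ P Q : ℝ[X], P.natDegree ≤ m → Q.natDegree ≤ m →
      (∀ i < k, (derivative^[i] P).eval 0 = (derivative^[i] Q).eval 0) →
      (∀ i < l, (derivative^[i] P).eval 1 = (derivative^[i] Q).eval 1) →
      (∀ j ∈ Icc k (m - l), jacobiInner α β (fun t => P.eval t)
        (fun t => (bernsteinPolynomial ℝ m j).eval t) = jacobiInner α β (fun t => Q.eval t)
        (fun t => (bernsteinPolynomial ℝ m j).eval t)) → P = Q := by
    intro P Q hP hQ h0 h1 hB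
    have hin : InConstrainedSpace m k l (P - Q) :=
      ⟨(natDegree_sub_le_of_le hP hQ).trans_eq (max_self m), fun i hi => by simp [iterate_map_sub, h0 i hi],
        fun i hi => by simp [iterate_map_sub, h1 i hi]⟩
    refine sub_eq_zero.1 (hin.eq_zero_of_orthogonal hkl hα hβ fun j hj => ?_)
    simp only [eval_sub]
    rw [jacobiInner_sub_left hα hβ (continuousOn_eval _ _) (continuousOn_eval _ _)
      (continuousOn_eval _ _), hB j hj, sub_self]
  have hval : ∀ P Q : degreeLT ℝ (m + 1), hermiteMoments m k l hα hβ P =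
      hermiteMoments m k l hα hβ Q → P = Q := by
    intro P Q hPQ
    have h := fun i : Fin (m + 1) => congrFun hPQ i
    simp only [hermiteMoments, LinearMap.coe_mk, AddHom.coe_mk] at h
    refine Subtype.ext (huniq P Q (mem_degreeLT_succ_iff.1 P.2) (mem_degreeLT_succ_iff.1 Q.2)
      (fun i hi => ?_) (fun i hi => ?_) (fun i hi => ?_))
    · have := h ⟨i, by omega⟩
      simpa [hi] using this
    -- The derivative of order `i` at `1` is stored at index `m - i`.
    · have := h ⟨m - i, by omega⟩
      simpa [show ¬ m - i < k by omega, show ¬ m - i ≤ m - l by omega,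
        show m - (m - i) = i by omega] using this
    · rw [mem_Icc] at hi
      have := h ⟨i, by omega⟩
      simpa [show ¬ i < k by omega, hi.2] using this
  have hfin : FiniteDimensional ℝ (degreeLT ℝ (m + 1)) :=
    (degreeLTEquiv ℝ (m + 1)).symm.finiteDimensional
  have hsurj := (LinearMap.injective_iff_surjective_of_finrank_eq_finrank
    (degreeLTEquiv ℝ (m + 1)).finrank_eq).1 (fun P Q h => hval P Q h)
  obtain ⟨P, hP⟩ := hsurj (fun i => if (i : ℕ) < k then a i else
    if (i : ℕ) ≤ m - l then d i else b (m - i))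
  have h := fun i : Fin (m + 1) => congrFun hP i
  simp only [hermiteMoments, LinearMap.coe_mk, AddHom.coe_mk] at h
  have h0 : ∀ i < k, (derivative^[i] (P : ℝ[X])).eval 0 = a i := fun i hi => by
    have := h ⟨i, by omega⟩
    simpa [hi] using this
  have h1 : ∀ i < l, (derivative^[i] (P : ℝ[X])).eval 1 = b i := fun i hi => by
    have := h ⟨m - i, by omega⟩
    simpa [show ¬ m - i < k by omega, show ¬ m - i ≤ m - l by omega,
      show m - (m - i) = i by omega] using this
  have hB : ∀ j ∈ Icc k (m - l), jacobiInner α β (fun t => (P : ℝ[X]).eval t)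
      (fun t => (bernsteinPolynomial ℝ m j).eval t) = d j := fun i hi => by
    rw [mem_Icc] at hi
    have := h ⟨i, by omega⟩
    simpa [show ¬ i < k by omega, hi.2] using this
  refine ⟨P, ⟨mem_degreeLT_succ_iff.1 P.2, h0, h1, hB⟩, ?_⟩
  rintro Q ⟨hQ, hQ0, hQ1, hQB⟩
  refine huniq Q P hQ (mem_degreeLT_succ_iff.1 P.2) (fun i hi => ?_) (fun i hi => ?_)
    (fun i hi => ?_)
  · rw [hQ0 i hi, h0 i hi]
  · rw [hQ1 i hi, h1 i hi]
  · rw [hQB i hi, hB i hi]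

theorem existsUnique_isConstrainedDual {m k l : ℕ} (hkl : k + l ≤ m) {α β : ℝ} (hα : -1 < α)
    (hβ : -1 < β) (i : ℕ) : ∃! D : ℝ[X], IsConstrainedDual m k l α β i D := by
  simpa only [IsConstrainedDual, InConstrainedSpace, and_assoc] using
    existsUnique_hermiteMoments hkl hα hβ (fun _ => 0) (fun _ => 0) (fun j => if i = j then 1 else 0)

theorem exists_isDualCoefficients {m k l : ℕ} (hkl : k + l ≤ m) {α β : ℝ} (hα : -1 < α)
    (hβ : -1 < β) : ∃ c : ℕ → ℕ → ℝ, IsDualCoefficients m k l α β c := by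
  choose D hD _ using existsUnique_isConstrainedDual hkl hα hβ
  choose c hc using fun i => (hD i).1.exists_eq_sum hkl
  exact ⟨c, fun i _ => hc i ▸ hD i⟩

/-! ### Orthogonality characterisations of the best approximation. -/

theorem sqError_eq {α β : ℝ} (hα : -1 < α) (hβ : -1 < β) {R : ℝ → ℝ}
    (hR : ContinuousOn R (Set.Icc 0 1)) (P Q : ℝ[X]) :
    sqError α β R (P + Q) = sqError α β R P -
      2 * jacobiInner α β (fun t => R t - P.eval t) (fun t => Q.eval t) +
      jacobiInner α β (fun t => Q.eval t) (fun t => Q.eval t) := by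
  unfold sqError
  have hE : ContinuousOn (fun t => R t - P.eval t) (Set.Icc 0 1) := continuousOn_sub_eval hR P
  have hQ := continuousOn_eval Q (Set.Icc 0 1)
  have e : (fun t => R t - (P + Q).eval t) = fun t => (R t - P.eval t) - Q.eval t := by
    ext t; rw [eval_add]; ring
  rw [e, jacobiInner_sub_left hα hβ hE hQ (continuousOn_sub_eval hE Q), jacobiInner_comm,
    jacobiInner_sub_left hα hβ hE hQ hE, jacobiInner_comm α β (fun t => Q.eval t) (fun t => _ - _),
    jacobiInner_comm α β (fun t => Q.eval t) (fun t => R t - P.eval t - Q.eval t),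
    jacobiInner_sub_left hα hβ hE hQ hQ]
  ring

theorem IsAdmissible.add {m k l : ℕ} {R : ℝ → ℝ} {P Q : ℝ[X]} (hP : IsAdmissible m k l R P)
    (hQ : InConstrainedSpace m k l Q) : IsAdmissible m k l R (P + Q) :=
  ⟨natDegree_add_le_of_degree_le hP.1 hQ.1,
    fun i hi => by rw [iterate_map_add, eval_add, hQ.2.1 i hi, hP.2.1 i hi, add_zero],
    fun i hi => by rw [iterate_map_add, eval_add, hQ.2.2 i hi, hP.2.2 i hi, add_zero]⟩

theorem IsAdmissible.sub {m k l : ℕ} {R : ℝ → ℝ} {P Q : ℝ[X]} (hP : IsAdmissible m k l R P)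
    (hQ : IsAdmissible m k l R Q) : InConstrainedSpace m k l (P - Q) :=
  ⟨(natDegree_sub_le_of_le hP.1 hQ.1).trans_eq (max_self m),
    fun i hi => by rw [iterate_map_sub, eval_sub, hQ.2.1 i hi, hP.2.1 i hi, sub_self],
    fun i hi => by rw [iterate_map_sub, eval_sub, hQ.2.2 i hi, hP.2.2 i hi, sub_self]⟩

theorem isBestApprox_iff_orthogonal {m k l : ℕ} {α β : ℝ} (hα : -1 < α) (hβ : -1 < β) {R : ℝ → ℝ}
    (hR : ContinuousOn R (Set.Icc 0 1)) (P : ℝ[X]) :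
    IsBestApprox m k l α β R P ↔ IsAdmissible m k l R P ∧
      ∀ Q : ℝ[X], InConstrainedSpace m k l Q →
        jacobiInner α β (fun t => R t - P.eval t) (fun t => Q.eval t) = 0 := by
  refine and_congr_right fun hP => ⟨fun h Q hQ => ?_, fun h S hS => ?_⟩
  · set b := jacobiInner α β (fun t => R t - P.eval t) (fun t => Q.eval t) with hb
    set c := jacobiInner α β (fun t => Q.eval t) (fun t => Q.eval t) with hc
    have hc0 : 0 ≤ c := jacobiInner_self_nonneg _ _ _
    have key : ∀ a : ℝ, 0 ≤ -2 * (a * b) + a * (a * c) := fun a => by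
      have := h (P + C a * Q) (hP.add (hQ.C_mul a))
      rw [sqError_eq hα hβ hR] at this
      simp only [eval_mul, eval_C] at this
      rw [jacobiInner_comm α β (fun t => R t - P.eval t), jacobiInner_const_mul_left,
        jacobiInner_comm α β (fun t => Q.eval t), ← hb, jacobiInner_const_mul_left,
        jacobiInner_comm α β (fun t => Q.eval t), jacobiInner_const_mul_left, ← hc] at this
      linarith
    -- The optimal step would be `b / c`; using `c + 1` avoids a separate case `c = 0` and still
    -- makes the error drop when `b ≠ 0`.
    have h1 := key (b / (c + 1))
    have hc1 : 0 < c + 1 := by linarith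
    have e : -2 * (b / (c + 1) * b) + b / (c + 1) * (b / (c + 1) * c) =
        -(b ^ 2 * (c + 2)) / (c + 1) ^ 2 := by
      field_simp; ring
    rw [e, le_div_iff₀ (by positivity)] at h1
    by_contra hb0
    have : 0 < b ^ 2 * (c + 2) := by positivity
    linarith
  · have e : S = P + (S - P) := by ring
    rw [e, sqError_eq hα hβ hR, h _ (hS.sub hP)]
    linarith [jacobiInner_self_nonneg α β (fun t => (S - P).eval t)]

/-- This puts the minimisation problem in the form solved by `existsUnique_hermiteMoments`. -/
theorem isBestApprox_iff_moments {m k l : ℕ} (hkl : k + l ≤ m) {α β : ℝ} (hα : -1 < α)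
    (hβ : -1 < β) {R : ℝ → ℝ} (hR : ContinuousOn R (Set.Icc 0 1)) (P : ℝ[X]) :
    IsBestApprox m k l α β R P ↔ IsAdmissible m k l R P ∧
      ∀ j ∈ Icc k (m - l), jacobiInner α β (fun t => P.eval t)
        (fun t => (bernsteinPolynomial ℝ m j).eval t) =
          jacobiInner α β R (fun t => (bernsteinPolynomial ℝ m j).eval t) := by
  rw [isBestApprox_iff_orthogonal hα hβ hR]
  refine and_congr_right fun _ => ⟨fun h j hj => ?_, fun h Q hQ => ?_⟩
  · have hB : InConstrainedSpace m k l (bernsteinPolynomial ℝ m j) := by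
      have := inConstrainedSpace_sum hkl (fun i => if i = j then 1 else 0)
      simpa [hj, ite_and, apply_ite C, sum_ite_eq', -mem_Icc] using this
    have := h _ hB
    rw [jacobiInner_sub_left hα hβ hR (continuousOn_eval _ _) (continuousOn_eval _ _)] at this
    linarith
  · obtain ⟨c, rfl⟩ := hQ.exists_eq_sum hkl
    rw [jacobiInner_eval_sum hα hβ _ _ _ (continuousOn_sub_eval hR P)]
    refine sum_eq_zero fun j hj => ?_
    rw [jacobiInner_sub_left hα hβ hR (continuousOn_eval _ _) (continuousOn_eval _ _), h j hj,
      sub_self, mul_zero]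

theorem existsUnique_isBestApprox {m k l : ℕ} (hkl : k + l ≤ m) {α β : ℝ} (hα : -1 < α)
    (hβ : -1 < β) {R : ℝ → ℝ} (hR : ContinuousOn R (Set.Icc 0 1)) :
    ∃! P : ℝ[X], IsBestApprox m k l α β R P := by
  simp only [isBestApprox_iff_moments hkl hα hβ hR, IsAdmissible, and_assoc]
  exact existsUnique_hermiteMoments hkl hα hβ _ _ _

/-- The orthogonality conditions may be tested on the constrained dual basis. -/
theorem isBestApprox_iff_dual {m k l : ℕ} (hkl : k + l ≤ m) {α β : ℝ} (hα : -1 < α)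
    (hβ : -1 < β) {R : ℝ → ℝ} (hR : ContinuousOn R (Set.Icc 0 1)) {D : ℕ → ℝ[X]}
    (hD : ∀ i ∈ Icc k (m - l), IsConstrainedDual m k l α β i (D i)) (P : ℝ[X]) :
    IsBestApprox m k l α β R P ↔ IsAdmissible m k l R P ∧
      ∀ i ∈ Icc k (m - l), jacobiInner α β (fun t => P.eval t) (fun t => (D i).eval t) =
          jacobiInner α β R (fun t => (D i).eval t) := by
  rw [isBestApprox_iff_orthogonal hα hβ hR]
  refine and_congr_right fun _ => ⟨fun h j hj => ?_, fun h Q hQ => ?_⟩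
  · have := h _ (hD j hj).1
    rw [jacobiInner_sub_left hα hβ hR (continuousOn_eval _ _) (continuousOn_eval _ _)] at this
    linarith
  · set a : ℕ → ℝ := fun i => jacobiInner α β (fun t => Q.eval t)
      (fun t => (bernsteinPolynomial ℝ m i).eval t) with ha
    have hS : InConstrainedSpace m k l (∑ i ∈ Icc k (m - l), C (a i) * D i) := by
      refine sum_induction _ (InConstrainedSpace m k l) (fun _ _ => InConstrainedSpace.add)
        ⟨by simp, by simp, by simp⟩ fun i hi => (hD i hi).1.C_mul _
    -- Dual expansion: both sides have the same moments against the inner Bernstein polynomials.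
    have hQS : Q = ∑ i ∈ Icc k (m - l), C (a i) * D i := by
      refine sub_eq_zero.1 ((hQ.sub hS).eq_zero_of_orthogonal hkl hα hβ fun j hj => ?_)
      simp only [eval_sub]
      rw [jacobiInner_sub_left hα hβ (continuousOn_eval _ _) (continuousOn_eval _ _)
        (continuousOn_eval _ _), jacobiInner_comm α β (fun t => (∑ i ∈ _, _ : ℝ[X]).eval t),
        jacobiInner_eval_sum hα hβ _ _ _ (continuousOn_eval _ _), sub_eq_zero]
      rw [sum_eq_single_of_mem j hj]
      · rw [jacobiInner_comm α β _ (fun t => (D j).eval t), (hD j hj).2 j hj, if_pos rfl, mul_one]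
      · intro i hi hij
        rw [jacobiInner_comm, (hD i hi).2 j hj, if_neg hij, mul_zero]
    rw [hQS, jacobiInner_eval_sum hα hβ _ _ _ (continuousOn_sub_eval hR P)]
    refine sum_eq_zero fun j hj => ?_
    rw [jacobiInner_sub_left hα hβ hR (continuousOn_eval _ _) (continuousOn_eval _ _), h j hj,
      sub_self, mul_zero]

/-! ### End point derivatives of the rational Bezier function. -/

theorem contDiff_eval (P : ℝ[X]) (i : WithTop ℕ∞) : ContDiff ℝ i (fun t => P.eval t) := by
  simpa using P.contDiff_aeval (𝕜 := ℝ) i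

theorem iteratedDerivWithin_eval (P : ℝ[X]) {s : Set ℝ} (hs : UniqueDiffOn ℝ s) {x : ℝ}
    (hx : x ∈ s) (i : ℕ) :
    iteratedDerivWithin i (fun t => P.eval t) s x = (derivative^[i] P).eval x := by
  induction i generalizing x with
  | zero => simp
  | succ i ih =>
    rw [iteratedDerivWithin_succ, derivWithin_congr (fun y hy => ih hy) (ih hx),
      Polynomial.derivWithin _ (hs x hx), Function.iterate_succ_apply']

/-- Leibniz rule for the quotient of two polynomials, solved for the highest derivative. -/
theorem iteratedDerivWithin_div_eval {N W : ℝ[X]} {s : Set ℝ} (hs : UniqueDiffOn ℝ s)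
    (hW : ∀ t ∈ s, W.eval t ≠ 0) {x : ℝ} (hx : x ∈ s) (i : ℕ) :
    iteratedDerivWithin i (fun t => N.eval t / W.eval t) s x =
      (W.eval x)⁻¹ * ((derivative^[i] N).eval x - ∑ j ∈ range i, (i.choose j : ℝ) *
        (derivative^[i - j] W).eval x *
          iteratedDerivWithin j (fun t => N.eval t / W.eval t) s x) := by
  have hR : ContDiffWithinAt ℝ i (fun t => N.eval t / W.eval t) s x :=
    (contDiff_eval N _).contDiffWithinAt.div (contDiff_eval W _).contDiffWithinAt (hW x hx)
  have hWc : ContDiffWithinAt ℝ i (fun t => W.eval t) s x := (contDiff_eval W _).contDiffWithinAt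
  have h1 : iteratedDerivWithin i
      ((fun t => N.eval t / W.eval t) * (fun t => W.eval t)) s x = (derivative^[i] N).eval x := by
    rw [← iteratedDerivWithin_eval N hs hx]
    exact iteratedDerivWithin_congr (fun t ht => div_mul_cancel₀ _ (hW t ht)) hx
  rw [iteratedDerivWithin_mul hx hs hR hWc, sum_range_succ] at h1
  simp only [iteratedDerivWithin_eval W hs hx] at h1
  rw [← h1, eq_inv_mul_iff_mul_eq₀ (hW x hx)]
  simp only [Nat.choose_self, Nat.cast_one, one_mul, Nat.sub_self, Function.iterate_zero, id]
  rw [show ∑ j ∈ range i, (i.choose j : ℝ) * (derivative^[i - j] W).eval x *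
        iteratedDerivWithin j (fun t => N.eval t / W.eval t) s x =
      ∑ j ∈ range i, (i.choose j : ℝ) *
        iteratedDerivWithin j (fun t => N.eval t / W.eval t) s x * (derivative^[i - j] W).eval x
    from sum_congr rfl fun j _ => by ring]
  ring

/-- Both sides vanish for `s > n`, so the truncated indices such as `n - i` in `rhoOne` are
harmless. -/
theorem descFactorial_eq_mul_recipFactorialSub (n s : ℕ) :
    (n.descFactorial s : ℝ) = (n ! : ℝ) * recipFactorialSub n s := by
  unfold recipFactorialSub
  split_ifs with h
  · rw [mul_one_div, eq_div_iff (by positivity), mul_comm]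
    exact_mod_cast Nat.factorial_mul_descFactorial h
  · rw [Nat.descFactorial_eq_zero_iff_lt.2 (not_le.1 h)]; simp

/-- The Bernstein polynomials are nonnegative on `[0, 1]` and sum to `1`, so they cannot all vanish
at a point. -/
theorem bernsteinForm_eval_pos {n : ℕ} {ω : ℕ → ℝ} (hω : ∀ i ≤ n, 0 < ω i) {t : ℝ}
    (ht : t ∈ Set.Icc (0 : ℝ) 1) : 0 < (bernsteinForm n ω).eval t := by
  have hB : ∀ i, 0 ≤ (bernsteinPolynomial ℝ n i).eval t := fun i => by
    have h1 : 0 ≤ 1 - t := by linarith [ht.2]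
    have h0 := ht.1
    simp only [bernsteinPolynomial, eval_mul, eval_pow, eval_sub, eval_one, eval_X, eval_natCast]
    positivity
  have hsum : ∑ i ∈ range (n + 1), (bernsteinPolynomial ℝ n i).eval t = 1 := by
    rw [← eval_finsetSum, bernsteinPolynomial.sum, eval_one]
  simp only [bernsteinForm, eval_finsetSum, eval_mul, eval_C]
  have hnn : ∀ i ∈ range (n + 1), 0 ≤ ω i * (bernsteinPolynomial ℝ n i).eval t := fun i hi =>
    mul_nonneg (hω i (Nat.lt_succ_iff.1 (mem_range.1 hi))).le (hB i)
  refine lt_of_le_of_ne (sum_nonneg hnn) fun h => ?_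
  have h' := (sum_eq_zero_iff_of_nonneg hnn).1 h.symm
  have : ∑ i ∈ range (n + 1), (bernsteinPolynomial ℝ n i).eval t = 0 :=
    sum_eq_zero fun i hi => (mul_eq_zero.1 (h' i hi)).resolve_left
      (hω i (Nat.lt_succ_iff.1 (mem_range.1 hi))).ne'
  rw [hsum] at this
  exact one_ne_zero this

theorem rationalBezier_continuousOn {n : ℕ} {ω : ℕ → ℝ} (hω : ∀ i ≤ n, 0 < ω i) (r : ℕ → ℝ) :
    ContinuousOn (rationalBezier n ω r) (Set.Icc 0 1) :=
  (Polynomial.continuous _).continuousOn.div (Polynomial.continuous _).continuousOn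
    fun _ ht => (bernsteinForm_eval_pos hω ht).ne'

/-- The recursion is the Leibniz rule for `R_n ω` solved for the top derivative of `R_n`, with the
polynomial derivatives at `0` written as forward differences. -/
theorem rhoZero_eq {n : ℕ} {ω : ℕ → ℝ} (hω : ∀ i ≤ n, 0 < ω i) (r : ℕ → ℝ) (i : ℕ) :
    rhoZero n ω r i = iteratedDerivWithin i (rationalBezier n ω r) (Set.Icc 0 1) 0 := by
  induction i using Nat.strong_induction_on with
  | _ i ih =>
    have h := iteratedDerivWithin_div_eval (N := bernsteinForm n (fun i => ω i * r i))
      (uniqueDiffOn_Icc zero_lt_one) (fun t ht => (bernsteinForm_eval_pos hω ht).ne')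
      (Set.left_mem_Icc.2 zero_le_one) i
    change iteratedDerivWithin i (rationalBezier n ω r) _ _ = _ at h
    rw [h, rhoZero, Fin.sum_univ_eq_sum_range (fun j => (i.choose j : ℝ) *
      (fwdDiff 1)^[i - j] ω 0 * recipFactorialSub n (i - j) * rhoZero n ω r j) i]
    simp only [iterate_derivative_bernsteinForm_eval_zero, eval_zero_bernsteinForm,
      descFactorial_eq_mul_recipFactorialSub]
    rw [div_eq_inv_mul, mul_assoc, mul_sub, mul_sum, mul_assoc]
    congr 2
    refine sum_congr rfl fun j hj => ?_
    rw [ih j (mem_range.1 hj)]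
    change _ = _ * iteratedDerivWithin j (rationalBezier n ω r) _ _
    ring

theorem rhoOne_eq {n : ℕ} {ω : ℕ → ℝ} (hω : ∀ i ≤ n, 0 < ω i) (r : ℕ → ℝ) (i : ℕ) :
    rhoOne n ω r i = iteratedDerivWithin i (rationalBezier n ω r) (Set.Icc 0 1) 1 := by
  induction i using Nat.strong_induction_on with
  | _ i ih =>
    have h := iteratedDerivWithin_div_eval (N := bernsteinForm n (fun i => ω i * r i))
      (uniqueDiffOn_Icc zero_lt_one) (fun t ht => (bernsteinForm_eval_pos hω ht).ne')
      (Set.right_mem_Icc.2 zero_le_one) i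
    change iteratedDerivWithin i (rationalBezier n ω r) _ _ = _ at h
    rw [h, rhoOne, Fin.sum_univ_eq_sum_range (fun j => (i.choose j : ℝ) *
      (fwdDiff 1)^[i - j] ω (n - (i - j)) * recipFactorialSub n (i - j) * rhoOne n ω r j) i]
    simp only [iterate_derivative_bernsteinForm_eval_one, eval_one_bernsteinForm,
      descFactorial_eq_mul_recipFactorialSub]
    rw [div_eq_inv_mul, mul_assoc, mul_sub, mul_sum, mul_assoc]
    congr 2
    refine sum_congr rfl fun j hj => ?_
    rw [ih j (mem_range.1 hj)]
    change _ = _ * iteratedDerivWithin j (rationalBezier n ω r) _ _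
    ring

/-! ### Moments of the dual polynomials and the numbers `K_{ij}`. -/

theorem integral_one_sub_rpow_mul_rpow {a b : ℝ} (ha : 0 < a) (hb : 0 < b) :
    ∫ t in (0 : ℝ)..1, (1 - t) ^ (b - 1) * t ^ (a - 1) =
      Real.Gamma a * Real.Gamma b / Real.Gamma (a + b) := by
  change _ = ProbabilityTheory.beta a b
  have h : ((∫ t in (0 : ℝ)..1, (1 - t) ^ (b - 1) * t ^ (a - 1) : ℝ) : ℂ) =
      Complex.betaIntegral a b := by
    rw [← intervalIntegral.integral_ofReal, Complex.betaIntegral]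
    refine intervalIntegral.integral_congr fun t ht => ?_
    rw [Set.uIcc_of_le zero_le_one] at ht
    simp only [Complex.ofReal_mul,
      Complex.ofReal_cpow ht.1, Complex.ofReal_cpow (sub_nonneg.2 ht.2)]
    push_cast
    ring
  rw [ProbabilityTheory.beta_eq_betaIntegralReal a b ha hb, ← h, Complex.ofReal_re]

theorem Gamma_add_nat {a : ℝ} (ha : 0 < a) (N : ℕ) :
    Real.Gamma (a + N) = risingFactorial a N * Real.Gamma a := by
  induction N with
  | zero => simp [risingFactorial]
  | succ N ih =>
    have e : a + ((N + 1 : ℕ) : ℝ) = (a + N) + 1 := by push_cast; ring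
    rw [e, Real.Gamma_add_one (by positivity), ih, risingFactorial, risingFactorial,
      prod_range_succ]
    ring

theorem risingFactorial_add (a : ℝ) (M N : ℕ) :
    risingFactorial a (M + N) = risingFactorial a M * risingFactorial (a + M) N := by
  unfold risingFactorial
  rw [prod_range_add]
  congr 1
  exact prod_congr rfl fun s _ => by push_cast; ring

theorem risingFactorial_pos {a : ℝ} (ha : 0 < a) (N : ℕ) : 0 < risingFactorial a N :=
  prod_pos fun s _ => by positivity

theorem jacobiInner_bernstein {m s j : ℕ} {α β : ℝ} (hα : -1 < α) (hβ : -1 < β) :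
    jacobiInner α β (fun t => (bernsteinPolynomial ℝ m s).eval t)
        (fun t => (bernsteinPolynomial ℝ m j).eval t) =
      (m.choose s : ℝ) * (m.choose j : ℝ) *
        (Real.Gamma (β + 1 + (s + j : ℕ)) * Real.Gamma (α + 1 + (m - s + (m - j) : ℕ)) /
          Real.Gamma (β + 1 + (s + j : ℕ) + (α + 1 + (m - s + (m - j) : ℕ)))) := by
  have h1 : 0 < β + 1 := by linarith
  have h2 : 0 < α + 1 := by linarith
  rw [← integral_one_sub_rpow_mul_rpow (by positivity) (by positivity),
    ← intervalIntegral.integral_const_mul, jacobiInner,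
    intervalIntegral.integral_of_le zero_le_one, intervalIntegral.integral_of_le zero_le_one,
    -- On the open interval `t` and `1 - t` are nonzero, as adding an integer to a real exponent
    -- requires.
    MeasureTheory.integral_Ioc_eq_integral_Ioo, MeasureTheory.integral_Ioc_eq_integral_Ioo]
  refine MeasureTheory.setIntegral_congr_fun measurableSet_Ioo fun t ht => ?_
  have ht1 : 1 - t ≠ 0 := by linarith [ht.2]
  simp only [bernsteinPolynomial, eval_mul, eval_pow, eval_sub, eval_one, eval_X, eval_natCast]
  rw [add_right_comm, add_sub_cancel_right, add_right_comm β, add_sub_cancel_right,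
    Real.rpow_add_natCast ht1, Real.rpow_add_natCast ht.1.ne', pow_add, pow_add]
  ring

/-- The inner products of an element of `Π_m^{(k,l)}` with the Bernstein polynomials are
values of a polynomial of degree at most `m - k - l`, up to explicit factors. -/
theorem exists_moment_polynomial {m k l : ℕ} (hkl : k + l ≤ m) {α β : ℝ} (hα : -1 < α)
    (hβ : -1 < β) (c : ℕ → ℝ) :
    ∃ Q : ℝ[X], Q.natDegree ≤ m - k - l ∧ ∀ j ≤ m,
      jacobiInner α β (fun t => (∑ s ∈ Icc k (m - l), C (c s) * bernsteinPolynomial ℝ m s).eval t)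
        (fun t => (bernsteinPolynomial ℝ m j).eval t) =
      (m.choose j : ℝ) * (risingFactorial (α + l + 1) (m - j) * risingFactorial (β + k + 1) j) *
        Q.eval (j : ℝ) := by
  have ha : 0 < α + l + 1 := by have : (0 : ℝ) ≤ l := l.cast_nonneg; linarith
  have hb : 0 < β + k + 1 := by have : (0 : ℝ) ≤ k := k.cast_nonneg; linarith
  -- In the beta integral of `B^m_s B^m_j`, `Γ(β+1+s+j)` equals `(β+k+1+j)_{s-k} (β+k+1)_j
  -- Γ(β+k+1)`, and the other numerator factor splits likewise with `(α+l+1+m-j)_{m-l-s}`. These two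
  -- products have degrees `s - k` and `m - l - s` in `j`; the denominator depends on neither `s`
  -- nor `j`.
  refine ⟨∑ s ∈ Icc k (m - l), C (c s * ((m.choose s : ℝ) * Real.Gamma (β + k + 1) *
      Real.Gamma (α + l + 1) / Real.Gamma (α + β + 2 + 2 * m))) *
    ((∏ x ∈ range (s - k), (X + C (β + k + 1 + x))) *
      ∏ x ∈ range (m - l - s), (C (α + l + 1 + m + x) - X)), ?_, fun j hj => ?_⟩
  · refine natDegree_sum_le_of_forall_le _ _ fun s hs => (natDegree_C_mul_le _ _).trans ?_
    rw [mem_Icc] at hs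
    have d1 : (∏ x ∈ range (s - k), (X + C (β + k + 1 + x) : ℝ[X])).natDegree ≤ s - k := by
      refine (natDegree_prod_le _ _).trans ((sum_le_card_nsmul _ _ 1 fun x _ => ?_).trans ?_)
      · compute_degree
      · simp
    have d2 : (∏ x ∈ range (m - l - s), (C (α + l + 1 + m + x) - X : ℝ[X])).natDegree ≤
        m - l - s := by
      refine (natDegree_prod_le _ _).trans ((sum_le_card_nsmul _ _ 1 fun x _ => ?_).trans ?_)
      · compute_degree
      · simp
    exact (natDegree_mul_le_of_le d1 d2).trans (by omega)
  · rw [jacobiInner_comm, jacobiInner_eval_sum hα hβ _ _ _ (continuousOn_eval _ _),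
      eval_finsetSum, mul_sum]
    refine sum_congr rfl fun s hs => ?_
    rw [mem_Icc] at hs
    obtain ⟨a, rfl⟩ := Nat.exists_eq_add_of_le hs.1
    obtain ⟨b, hb'⟩ := Nat.exists_eq_add_of_le hs.2
    obtain ⟨d, rfl⟩ := Nat.exists_eq_add_of_le hj
    have e1 : β + 1 + ((j + (k + a) : ℕ) : ℝ) = β + k + 1 + ((j + a : ℕ) : ℝ) := by
      push_cast; ring
    have e2 : α + 1 + ((j + d - j + (j + d - (k + a)) : ℕ) : ℝ) =
        α + l + 1 + ((d + b : ℕ) : ℝ) := by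
      rw [show j + d - j + (j + d - (k + a)) = d + b + l by omega]
      push_cast; ring
    have e3 : β + k + 1 + ((j + a : ℕ) : ℝ) + (α + l + 1 + ((d + b : ℕ) : ℝ)) =
        α + β + 2 + 2 * ((j + d : ℕ) : ℝ) := by
      have : ((j + d : ℕ) : ℝ) = ((k + a + b + l : ℕ) : ℝ) := by
        congr 1; omega
      push_cast at this ⊢
      linarith
    have p1 : (∏ x ∈ range (k + a - k), (X + C (β + k + 1 + x) : ℝ[X])).eval (j : ℝ) =
        risingFactorial (β + k + 1 + j) a := by
      rw [Nat.add_sub_cancel_left, eval_prod]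
      refine prod_congr rfl fun x _ => ?_
      simp only [eval_add, eval_X, eval_C]; ring
    have p2 : (∏ x ∈ range (j + d - l - (k + a)),
        (C (α + l + 1 + ((j + d : ℕ) : ℝ) + x) - X : ℝ[X])).eval (j : ℝ) =
        risingFactorial (α + l + 1 + d) b := by
      rw [hb', Nat.add_sub_cancel_left, eval_prod]
      refine prod_congr rfl fun x _ => ?_
      simp only [eval_sub, eval_X, eval_C]; push_cast; ring
    rw [jacobiInner_bernstein hα hβ, eval_mul, eval_mul, eval_C, p1, p2, e1, e2, e3,
      Gamma_add_nat hb, Gamma_add_nat ha, risingFactorial_add, risingFactorial_add,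
      Nat.add_sub_cancel_left]
    ring

/-- The Lagrange denominator at equally spaced nodes: nodes below `a` give `a!`, those above give
`(-1)^b b!`. -/
theorem prod_range_erase_sub (a b : ℕ) :
    ∏ s ∈ (range (a + b + 1)).erase a, ((a : ℝ) - s) = (a ! : ℝ) * ((-1) ^ b * (b ! : ℝ)) := by
  have h : (range (a + b + 1)).erase a = range a ∪ Ico (a + 1) (a + 1 + b) := by
    ext x
    simp only [mem_erase, mem_range, mem_union, mem_Ico]
    omega
  have hd : Disjoint (range a) (Ico (a + 1) (a + 1 + b)) := by
    rw [disjoint_left]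
    intro x hx hx'
    rw [mem_range] at hx
    rw [mem_Ico] at hx'
    omega
  rw [h, prod_union hd, prod_Ico_eq_prod_range, Nat.add_sub_cancel_left]
  congr 1
  · rw [← prod_range_reflect, ← prod_range_add_one_eq_factorial]
    push_cast
    refine prod_congr rfl fun x hx => ?_
    rw [mem_range] at hx
    rw [show a - 1 - x = a - (x + 1) by omega, Nat.cast_sub (by omega)]
    push_cast; ring
  · rw [← prod_range_add_one_eq_factorial]
    push_cast
    rw [← card_range b, ← prod_const, card_range, ← prod_mul_distrib]
    exact prod_congr rfl fun x _ => by ring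

/-- Lagrange extrapolation from the nodes `k, …, k + a + b` of a polynomial which vanishes at all
of them except `k + a`. -/
theorem eval_eq_of_vanish {k a b j : ℕ} {Q : ℝ[X]} (hQ : Q.natDegree ≤ a + b)
    (h : ∀ s ∈ Icc k (k + a + b), s ≠ k + a → Q.eval (s : ℝ) = 0) (hj : j ≠ k + a) :
    Q.eval (j : ℝ) = (-1) ^ a * risingFactorial ((k : ℝ) - j) (a + b + 1) /
      (((k + a : ℕ) : ℝ) - j) / (a ! : ℝ) / (b ! : ℝ) * Q.eval ((k + a : ℕ) : ℝ) := by
  set W : ℝ[X] := ∏ s ∈ (range (a + b + 1)).erase a, (X - C ((k : ℝ) + s)) with hW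
  have hWa : W.eval ((k + a : ℕ) : ℝ) = (a ! : ℝ) * ((-1) ^ b * (b ! : ℝ)) := by
    rw [← prod_range_erase_sub, hW, eval_prod]
    refine prod_congr rfl fun x _ => ?_
    simp only [eval_sub, eval_X, eval_C]; push_cast; ring
  -- Restoring the omitted node completes the product to a rising factorial, with one sign for each
  -- of the `a + b + 1` factors.
  have hWj : W.eval (j : ℝ) * ((j : ℝ) - (k + a : ℕ)) =
      (-1) ^ (a + b + 1) * risingFactorial ((k : ℝ) - j) (a + b + 1) := by
    have : (j : ℝ) - (k + a : ℕ) = (X - C ((k : ℝ) + a)).eval (j : ℝ) := by simp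
    rw [this, ← eval_mul, hW, prod_erase_mul _ _ (mem_range.2 (by omega)), eval_prod,
      risingFactorial]
    nth_rewrite 2 [← card_range (a + b + 1)]
    rw [← prod_const, ← prod_mul_distrib]
    exact prod_congr rfl fun x _ => by simp only [eval_sub, eval_X, eval_C]; ring
  have hWd : W.natDegree ≤ a + b := by
    rw [hW, natDegree_finsetProd_X_sub_C_eq_card, card_erase_of_mem (mem_range.2 (by omega)),
      card_range]
    omega
  -- Degree at most `a + b`, but `a + b + 1` zeros: away from `k + a` both `Q` and `W` vanish, and
  -- at `k + a` the terms cancel.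
  have key : Q * C (W.eval ((k + a : ℕ) : ℝ)) - C (Q.eval ((k + a : ℕ) : ℝ)) * W = 0 := by
    refine eq_zero_of_natDegree_lt_card_of_eval_eq_zero' _
      ((Icc k (k + a + b)).map Nat.castEmbedding) (fun x hx => ?_) ?_
    · obtain ⟨s, hs, rfl⟩ := mem_map.1 hx
      simp only [Nat.castEmbedding_apply, eval_sub, eval_mul, eval_C]
      by_cases hsa : s = k + a
      · rw [hsa]; ring
      · have hWs : W.eval (s : ℝ) = 0 := by
          rw [mem_Icc] at hs
          rw [hW, eval_prod]
          refine prod_eq_zero (i := s - k) ?_ ?_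
          · rw [mem_erase, mem_range]
            omega
          · rw [Nat.cast_sub hs.1]; simp
        rw [h s hs hsa, hWs]; ring
    · rw [card_map, Nat.card_Icc]
      refine lt_of_le_of_lt ((natDegree_sub_le_of_le ((natDegree_mul_C_le _ _).trans hQ)
        ((natDegree_C_mul_le _ _).trans hWd)).trans_eq (max_self _)) (by omega)
  have hev := congrArg (eval (j : ℝ)) key
  simp only [eval_sub, eval_mul, eval_C, eval_zero, hWa] at hev
  have hne : ((k + a : ℕ) : ℝ) - j ≠ 0 := sub_ne_zero.2 (by exact_mod_cast hj.symm)
  have ha : (a ! : ℝ) ≠ 0 := by positivity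
  have hb : (b ! : ℝ) ≠ 0 := by positivity
  have s1 : ((-1 : ℝ) ^ b) * (-1) ^ b = 1 := by rw [← pow_add, ← two_mul, pow_mul]; simp
  rw [div_div, div_div, div_mul_eq_mul_div, eq_div_iff (by positivity)]
  rw [pow_succ, pow_add] at hWj
  linear_combination ((-1) ^ b * (((k + a : ℕ) : ℝ) - j)) * hev +
    (-(Q.eval ((k + a : ℕ) : ℝ)) * (-1) ^ b) * hWj +
    ((-1) ^ a * risingFactorial ((k : ℝ) - j) (a + b + 1) * Q.eval ((k + a : ℕ) : ℝ) -
      Q.eval (j : ℝ) * ((((k + a : ℕ) : ℝ) - j) * a ! * b !)) * s1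

/-- Duality forces the moment polynomial to vanish at inner indices other than `i` and fixes its
value at `i`. Extrapolating to `j` gives the rational factor of `K_{ij}`; the rest is the ratio of
the explicit factors at `j` and at `i`. -/
theorem jacobiInner_dual_eq_kernelCoeff {m k l : ℕ} (hkl : k + l ≤ m) {α β : ℝ} (hα : -1 < α)
    (hβ : -1 < β) {i j : ℕ} (hi : i ∈ Icc k (m - l)) (hjm : j ≤ m) (hj : j ∉ Icc k (m - l))
    {D : ℝ[X]} (hD : IsConstrainedDual m k l α β i D) :
    jacobiInner α β (fun t => D.eval t) (fun t => (bernsteinPolynomial ℝ m j).eval t) =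
      kernelCoeff m k l α β i j := by
  have ha : 0 < α + l + 1 := by have : (0 : ℝ) ≤ l := l.cast_nonneg; linarith
  have hb : 0 < β + k + 1 := by have : (0 : ℝ) ≤ k := k.cast_nonneg; linarith
  obtain ⟨c, hc⟩ := hD.1.exists_eq_sum hkl
  obtain ⟨Q, hQd, hQ⟩ := exists_moment_polynomial hkl hα hβ c
  rw [← hc] at hQ
  have hfac : ∀ s ≤ m, (m.choose s : ℝ) *
      (risingFactorial (α + l + 1) (m - s) * risingFactorial (β + k + 1) s) ≠ 0 := fun s hs =>
    mul_ne_zero (by exact_mod_cast (Nat.choose_pos hs).ne')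
      (mul_pos (risingFactorial_pos ha _) (risingFactorial_pos hb _)).ne'
  have hi' := mem_Icc.1 hi
  have hQi : Q.eval (i : ℝ) = ((m.choose i : ℝ) *
      (risingFactorial (α + l + 1) (m - i) * risingFactorial (β + k + 1) i))⁻¹ := by
    refine eq_inv_of_mul_eq_one_left ?_
    rw [mul_comm, ← hQ i (by omega), hD.2 i hi,
      if_pos rfl]
  have hQs : ∀ s ∈ Icc k (m - l), s ≠ i → Q.eval (s : ℝ) = 0 := fun s hs hsi => by
    have hs' := mem_Icc.1 hs
    have := hQ s (by omega)
    rw [hD.2 s hs, if_neg (Ne.symm hsi)] at this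
    exact (mul_eq_zero.1 this.symm).resolve_left (hfac s (by omega))
  have hji : j ≠ i := fun h => hj (h ▸ hi)
  rw [hQ j hjm]
  obtain ⟨a, rfl⟩ := Nat.exists_eq_add_of_le hi'.1
  obtain ⟨b, hb'⟩ := Nat.exists_eq_add_of_le hi'.2
  rw [show m - k - l = a + b by omega] at hQd
  rw [hb'] at hQs
  rw [eval_eq_of_vanish hQd hQs hji, hQi, kernelCoeff, show m - k - l = a + b by omega, hb',
    Nat.add_sub_cancel_left, Nat.add_sub_cancel_left]
  rw [mul_inv, mul_inv]
  simp only [div_eq_mul_inv, mul_inv]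
  ring

/-! ### Both sides of the dual equations, and the conclusion. -/

theorem bernstein_mul_bernstein {n m h j : ℕ} (hh : h ≤ n) (hj : j ≤ m) (t : ℝ) :
    (bernsteinPolynomial ℝ n h).eval t * (bernsteinPolynomial ℝ m j).eval t =
      (n.choose h : ℝ) * (m.choose j : ℝ) * ((n + m).choose (j + h) : ℝ)⁻¹ *
        (bernsteinPolynomial ℝ (n + m) (j + h)).eval t := by
  have hne : ((n + m).choose (j + h) : ℝ) ≠ 0 := by
    exact_mod_cast (Nat.choose_pos (by omega)).ne'
  simp only [bernsteinPolynomial, eval_mul, eval_pow, eval_sub, eval_one, eval_X, eval_natCast]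
  rw [show n + m - (j + h) = n - h + (m - j) by omega, pow_add, pow_add]
  field_simp

theorem jacobiInner_rationalBezier {n m a b : ℕ} (hb : b ≤ m) {α β : ℝ} (hα : -1 < α)
    (hβ : -1 < β) {ω : ℕ → ℝ} (hω : ∀ i ≤ n, 0 < ω i) (r c : ℕ → ℝ) :
    jacobiInner α β (rationalBezier n ω r)
        (fun t => (∑ j ∈ Icc a b, C (c j) * bernsteinPolynomial ℝ m j).eval t) =
      ∑ h ∈ range (n + 1), (n.choose h : ℝ) * ω h * r h *
        ∑ j ∈ Icc a b, (m.choose j : ℝ) * ((n + m).choose (j + h) : ℝ)⁻¹ *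
          c j * weightedIntegral n m α β ω (j + h) := by
  rw [jacobiInner_eval_sum hα hβ _ _ _ (rationalBezier_continuousOn hω r)]
  have hcont : ∀ h, ContinuousOn (fun t => (bernsteinPolynomial ℝ n h).eval t /
      (bernsteinForm n ω).eval t) (Set.Icc 0 1) := fun h =>
    (continuousOn_eval _ _).div (continuousOn_eval _ _)
      fun _ ht => (bernsteinForm_eval_pos hω ht).ne'
  have hR : rationalBezier n ω r = fun t => ∑ h ∈ range (n + 1), ω h * r h *
      ((bernsteinPolynomial ℝ n h).eval t / (bernsteinForm n ω).eval t) := by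
    ext t
    simp only [rationalBezier]
    rw [bernsteinForm, eval_finsetSum, sum_div]
    exact sum_congr rfl fun h _ => by rw [eval_mul, eval_C, mul_div_assoc]
  have hB : ∀ j ∈ Icc a b, jacobiInner α β (rationalBezier n ω r)
      (fun t => (bernsteinPolynomial ℝ m j).eval t) = ∑ h ∈ range (n + 1), ω h * r h *
        ((n.choose h : ℝ) * (m.choose j : ℝ) * ((n + m).choose (j + h) : ℝ)⁻¹ *
          weightedIntegral n m α β ω (j + h)) := by
    intro j hj
    rw [hR, jacobiInner_sum_left hα hβ _ (f := fun h t => ω h * r h *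
      ((bernsteinPolynomial ℝ n h).eval t / (bernsteinForm n ω).eval t)) (fun h _ => continuousOn_const.mul (hcont h))
      (continuousOn_eval _ _)]
    refine sum_congr rfl fun h hh => ?_
    rw [jacobiInner_const_mul_left, weightedIntegral, ← intervalIntegral.integral_const_mul,
      jacobiInner]
    congr 2
    ext t
    have := bernstein_mul_bernstein (Nat.lt_succ_iff.1 (mem_range.1 hh))
      ((mem_Icc.1 hj).2.trans hb) t
    simp only [div_eq_mul_inv]
    linear_combination ((1 - t) ^ α * t ^ β * ((bernsteinForm n ω).eval t)⁻¹) * this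
  rw [sum_congr rfl fun j hj => by rw [hB j hj]]
  simp only [mul_sum]
  rw [sum_comm]
  exact sum_congr rfl fun h _ => sum_congr rfl fun j _ => by ring

theorem sum_range_succ_eq_split {m k l : ℕ} (hkl : k + l ≤ m) (f : ℕ → ℝ) :
    ∑ j ∈ range (m + 1), f j = ∑ j ∈ Icc k (m - l), f j +
      (∑ j ∈ range k, f j + ∑ j ∈ Icc (m - l + 1) m, f j) := by
  rw [← sum_union, ← sum_union]
  · refine sum_congr ?_ fun _ _ => rfl
    ext x
    simp only [mem_union, mem_range, mem_Icc]
    omega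
  · rw [disjoint_left]
    intro x
    simp only [mem_union, mem_range, mem_Icc]
    omega
  · rw [disjoint_left]
    intro x
    simp only [mem_range, mem_Icc]
    omega

/-- Among inner indices duality keeps only `p i`; the outer ones contribute the kernel. -/
theorem jacobiInner_bernsteinForm_dual {m k l : ℕ} (hkl : k + l ≤ m) {α β : ℝ} (hα : -1 < α)
    (hβ : -1 < β) {i : ℕ} (hi : i ∈ Icc k (m - l)) {D : ℝ[X]}
    (hD : IsConstrainedDual m k l α β i D) (p : ℕ → ℝ) :
    jacobiInner α β (fun t => (bernsteinForm m p).eval t) (fun t => D.eval t) =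
      p i + (∑ j ∈ range k, p j * kernelCoeff m k l α β i j +
        ∑ j ∈ Icc (m - l + 1) m, p j * kernelCoeff m k l α β i j) := by
  rw [jacobiInner_comm, bernsteinForm, jacobiInner_eval_sum hα hβ _ _ _ (continuousOn_eval _ _),
    sum_range_succ_eq_split hkl]
  congr 1
  · rw [sum_eq_single_of_mem i hi]
    · rw [hD.2 i hi, if_pos rfl, mul_one]
    · intro j hj hji
      rw [hD.2 j hj, if_neg hji.symm, mul_zero]
  · congr 1
    · refine sum_congr rfl fun j hj => ?_
      rw [mem_range] at hj
      rw [jacobiInner_dual_eq_kernelCoeff hkl hα hβ hi (by omega) (by rw [mem_Icc]; omega) hD]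
    · refine sum_congr rfl fun j hj => ?_
      rw [mem_Icc] at hj
      rw [jacobiInner_dual_eq_kernelCoeff hkl hα hβ hi (by omega) (by rw [mem_Icc]; omega) hD]

end

theorem theorem3p1 (n m k l : ℕ) (hkl : k + l ≤ m) (α β : ℝ) (hα : -1 < α) (hβ : -1 < β)
    (ω r : ℕ → ℝ) (hω : ∀ i ≤ n, 0 < ω i) :
    -- the constrained dual Bernstein polynomials exist, are unique, and have coefficients `c`
    (∀ i ∈ Icc k (m - l), ∃! D : ℝ[X], IsConstrainedDual m k l α β i D) ∧
    (∃ c : ℕ → ℕ → ℝ, IsDualCoefficients m k l α β c) ∧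
    -- the constrained least squares problem has exactly one solution
    (∃! P : ℝ[X], IsBestApprox m k l α β (rationalBezier n ω r) P) ∧
    -- the recursively defined numbers are the derivatives at the end points
    (∀ i : ℕ,
      rhoZero n ω r i = iteratedDerivWithin i (rationalBezier n ω r) (Set.Icc 0 1) 0 ∧
      rhoOne n ω r i = iteratedDerivWithin i (rationalBezier n ω r) (Set.Icc 0 1) 1) ∧
    -- the Bernstein coefficients of the solution are given by the formulas
    ∀ c : ℕ → ℕ → ℝ, IsDualCoefficients m k l α β c → ∀ p : ℕ → ℝ,
      (IsBestApprox m k l α β (rationalBezier n ω r) (bernsteinForm m p) ↔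
        (∀ i < k, p i = ((m - i)! : ℝ) / (m ! : ℝ) * rhoZero n ω r i -
          ∑ j ∈ range i, (-1) ^ (i + j) * (i.choose j : ℝ) * p j) ∧
        (∀ i < l, p (m - i) = (-1) ^ i * (((m - i)! : ℝ) / (m ! : ℝ)) * rhoOne n ω r i -
          ∑ j ∈ Icc 1 i, (-1) ^ j * (i.choose j : ℝ) * p (m - i + j)) ∧
        (∀ i ∈ Icc k (m - l), p i =
          ∑ h ∈ range (n + 1), (n.choose h : ℝ) * ω h * r h *
            ∑ j ∈ Icc k (m - l), (m.choose j : ℝ) * ((n + m).choose (j + h) : ℝ)⁻¹ *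
              c i j * weightedIntegral n m α β ω (j + h) -
          (∑ j ∈ range k, p j * kernelCoeff m k l α β i j +
            ∑ j ∈ Icc (m - l + 1) m, p j * kernelCoeff m k l α β i j))) := by
  have hR := rationalBezier_continuousOn hω r
  refine ⟨fun i _ => existsUnique_isConstrainedDual hkl hα hβ i,
    exists_isDualCoefficients hkl hα hβ, existsUnique_isBestApprox hkl hα hβ hR,
    fun i => ⟨rhoZero_eq hω r i, rhoOne_eq hω r i⟩, fun c hc p => ?_⟩
  -- Through `hc` the dual polynomials are the sums with coefficients `c i j`. A Bernstein form
  -- meets the degree bound automatically, so three families of equations remain, each equivalent to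
  -- one formula.
  rw [isBestApprox_iff_dual hkl hα hβ hR hc, IsAdmissible,
    and_iff_right (natDegree_bernsteinForm_le m p), and_assoc]
  refine and_congr ?_ (and_congr ?_ ?_)
  · refine forall₂_congr fun i hi => ?_
    rw [← rhoZero_eq hω, iterate_derivative_bernsteinForm_eval_zero_eq_iff (by omega)]
  · refine forall₂_congr fun i hi => ?_
    rw [← rhoOne_eq hω, iterate_derivative_bernsteinForm_eval_one_eq_iff (by omega)]
  · refine forall₂_congr fun i hi => ?_
    rw [jacobiInner_bernsteinForm_dual hkl hα hβ hi (hc i hi),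
      jacobiInner_rationalBezier (Nat.sub_le m l) hα hβ hω, eq_sub_iff_add_eq]
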